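/- Let $X$ be an at most countable set and $m\colon X\to(0,\infty)$, extended by additivity to a measure on all subsets of $X$, with $m(X)<\infty$. Let $Q$ be a Dirichlet form on the complex Hilbert space $\ell^2(X,m)$ with domain $D(Q)$, that is, a densely defined, closed, nonnegative quadratic form, given by a Hermitian sesquilinear form on the subspace $D(Q)$, such that $C\circ u\in D(Q)$ and $Q(C\circ u)\le Q(u)$ for every $u\in D(Q)$ and every $C\colon\mathbb C\to\mathbb C$ with $C(0)=0$ and $|C(s)-C(t)|\le|s-t|$ for all $s,t\in\mathbb C$. Let $L$ be its generator, i.e. the positive self-adjoint operator with $D(L^{1/2})=D(Q)$ and $Q(u)=\|L^{1/2}u\|_2^2$ for $u\in D(Q)$. Let $\alpha\ge 0$ and $o\in X$, and suppose that $Q$ satisfies an $\ell^\infty_{\alpha,o}$-Sobolev inequality: there is a constant $S$ with $$\|u\|_\infty^2\le S\,\bigl(Q(u)+\alpha|u(o)|^2\bigr)\qquad\text{for all }u\in D(Q).$$ Let $S_{\infty,\alpha,o}(Q)$ denote the minimal such constant. Then the spectrum of $L$ is purely discrete, i.e. it consists of isolated points that are eigenvalues of finite multiplicity. Moreover, the eigenvalues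 of $L$, counted with multiplicity, can be listed in nondecreasing order as $\lambda_1\le\lambda_2\le\cdots$ (with index $1\le k\le |X|$ if $X$ is finite, and all $k\ge 1$ if $X$ is infinite), and for every such $k$ $$\lambda_k\ \ge\ \frac{k}{S_{\infty,\alpha,o}(Q)\,m(X)}-\frac{\alpha}{m(o)}.$$ -/

import Mathlib

open MeasureTheory Filter Topology
open scoped ENNReal InnerProductSpace

noncomputable section

namespace DiscreteDirichlet

/-! ### Discrete measure spaces -/

/-- The measure on `X` obtained by additivity from a weight function `m`. -/
def weightMeasure {X : Type*} [MeasurableSpace X] (m : X → ℝ) : Measure X :=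
  Measure.sum fun x => ENNReal.ofReal (m x) • Measure.dirac x

/-- The complex Hilbert space `ℓ²(X, m)`.  When `m` is strictly positive and all subsets of `X` are
measurable, the only null set is the empty one, so that elements are honest functions. -/
abbrev Ell2 {X : Type*} [MeasurableSpace X] (m : X → ℝ) : Type _ :=
  Lp ℂ 2 (weightMeasure m)

/-! ### Dirichlet forms -/

/-- A Dirichlet form on `ℓ²(X, m)`: a densely defined, closed, nonnegative Hermitian form with which
all normal contractions `C : ℂ → ℂ` are compatible.  The form is antilinear in its first and linear
in its second argument, as is the inner product. -/
structure DirichletForm {X : Type*} [MeasurableSpace X] (m : X → ℝ) where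
  /-- the form domain `D(Q)` -/
  domain : Submodule ℂ (Ell2 m)
  /-- the sesquilinear form `Q(u, v)` -/
  form : domain →ₗ⋆[ℂ] domain →ₗ[ℂ] ℂ
  hermitian : ∀ u v, form u v = starRingEnd ℂ (form v u)
  nonneg : ∀ u, 0 ≤ (form u u).re
  dense : Dense (domain : Set (Ell2 m))
  /-- If `u n → f` in `ℓ²` and `(u n)` is Cauchy with respect to `Q`, then `f ∈ D(Q)` and
  `Q(u n - f) → 0`. -/
  closed : ∀ (u : ℕ → domain) (f : Ell2 m),
    Tendsto (fun n => (u n : Ell2 m)) atTop (𝓝 f) →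
    (∀ ε > 0, ∃ N, ∀ i ≥ N, ∀ j ≥ N, (form (u i - u j) (u i - u j)).re < ε) →
    ∃ hf : f ∈ domain,
      Tendsto (fun n => (form (u n - ⟨f, hf⟩) (u n - ⟨f, hf⟩)).re) atTop (𝓝 0)
  /-- For a normal contraction `C` and `u ∈ D(Q)`: `C ∘ u ∈ D(Q)` and `Q(C ∘ u) ≤ Q(u)`. -/
  contraction : ∀ (C : ℂ → ℂ) (hC : LipschitzWith 1 C) (hC0 : C 0 = 0) (u : domain),
    ∃ h : hC.compLp hC0 (u : Ell2 m) ∈ domain,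
      (form ⟨_, h⟩ ⟨_, h⟩).re ≤ (form u u).re

namespace DirichletForm

variable {X : Type*} [MeasurableSpace X] {m : X → ℝ}

/-- The quadratic form `Q(u) = Q(u, u)` on the form domain. -/
def quad (Q : DirichletForm m) (u : Q.domain) : ℝ := (Q.form u u).re

/-- `S` is a constant in the `ℓ^p_{α,o}`-Sobolev inequality
`‖u‖_p² ≤ S (Q(u) + α |u(o)|²)` for all `u ∈ D(Q)` (in particular `D(Q) ⊆ ℓ^p`). -/
def IsSobolevBound (Q : DirichletForm m) (p : ℝ≥0∞) (α : ℝ) (o : X) (S : ℝ) : Prop :=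
  ∀ u : Q.domain, eLpNorm (u : Ell2 m) p (weightMeasure m) ^ 2 ≤
    ENNReal.ofReal (S * (Q.quad u + α * ‖(u : Ell2 m) o‖ ^ 2))

/-- `Q` satisfies an `ℓ^p_{α,o}`-Sobolev inequality. -/
def SobolevInequality (Q : DirichletForm m) (p : ℝ≥0∞) (α : ℝ) (o : X) : Prop :=
  ∃ S : ℝ, Q.IsSobolevBound p α o S

/-- The `ℓ^p_{α,o}`-Sobolev constant `S_{p,α,o}(Q)`, the minimal constant in the inequality. -/
def sobolevConstant (Q : DirichletForm m) (p : ℝ≥0∞) (α : ℝ) (o : X) : ℝ :=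
  sInf {S : ℝ | Q.IsSobolevBound p α o S}

/-- The graph of the generator: the pairs `(u, f)` with `u ∈ D(Q)` and `Q(v, u) = ⟨v, f⟩` for all
`v ∈ D(Q)`. -/
def generatorGraph (Q : DirichletForm m) : Submodule ℂ (Ell2 m × Ell2 m) where
  carrier := {w | ∃ h : w.1 ∈ Q.domain, ∀ v : Q.domain, Q.form v ⟨w.1, h⟩ = ⟪(v : Ell2 m), w.2⟫_ℂ}
  add_mem' := by
    rintro ⟨u, f⟩ ⟨u', f'⟩ ⟨h, hf⟩ ⟨h', hf'⟩
    refine ⟨Q.domain.add_mem h h', fun v => ?_⟩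
    have := map_add (Q.form v) ⟨u, h⟩ ⟨u', h'⟩
    rw [hf v, hf' v, ← inner_add_right] at this
    exact this
  zero_mem' := ⟨Q.domain.zero_mem, fun v => by
    have := map_zero (Q.form v)
    rw [← inner_zero_right (𝕜 := ℂ) (v : Ell2 m)] at this
    exact this⟩
  smul_mem' := by
    rintro c ⟨u, f⟩ ⟨h, hf⟩
    refine ⟨Q.domain.smul_mem c h, fun v => ?_⟩
    have := map_smul (Q.form v) c ⟨u, h⟩
    rw [hf v, smul_eq_mul, ← inner_smul_right] at this
    exact this

/-- The generator `L` of `Q`: the self-adjoint positive operator associated with the closed form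
`Q`, i.e. the one with `D(Q) = D(L^{1/2})` and `Q(u) = ‖L^{1/2} u‖²`. -/
def generator (Q : DirichletForm m) : Ell2 m →ₗ.[ℂ] Ell2 m := Q.generatorGraph.toLinearPMap

/-- The pairs in `generatorGraph` do form the graph of an operator, so that `generator` is this
operator. -/
theorem generator_graph (Q : DirichletForm m) : Q.generator.graph = Q.generatorGraph := by
  refine Submodule.toLinearPMap_graph_eq _ ?_
  rintro ⟨u, f⟩ ⟨h, hf⟩ (hu : u = 0)
  subst hu
  have hz : ∀ v : Q.domain, ⟪(v : Ell2 m), f⟫_ℂ = 0 := fun v => by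
    rw [← hf v]; exact map_zero (Q.form v)
  exact Q.dense.eq_zero_of_inner_right ℂ (fun v hv => hz ⟨v, hv⟩)

/-- Polarization. -/
theorem form_eq (Q : DirichletForm m) (A : Q.domain →ₗ[ℂ] Ell2 m)
    (hq : ∀ u : Q.domain, Q.quad u = ‖A u‖ ^ 2) (u v : Q.domain) : Q.form u v = ⟪A u, A v⟫_ℂ := by
  have hn : ∀ u : Q.domain, (Q.form u u).re = (⟪A u, A u⟫_ℂ).re := fun u =>
    (hq u).trans (inner_self_eq_norm_sq (𝕜 := ℂ) (A u)).symm
  have key : ∀ u v : Q.domain, (Q.form u v).re = (⟪A u, A v⟫_ℂ).re := fun u v => by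
    have h := hn (u + v)
    have h1 := congrArg Complex.re (Q.hermitian v u)
    have h2 := congrArg Complex.re (inner_conj_symm (𝕜 := ℂ) (A v) (A u))
    simp only [map_add, LinearMap.add_apply, inner_add_left, inner_add_right, Complex.add_re,
      Complex.conj_re, hn u, hn v] at h h1 h2
    linarith
  apply Complex.ext (key u v)
  have := key u ((-Complex.I) • v)
  simpa [inner_smul_right] using this

/-- The generator agrees with the description through the square root: if `A` is a self-adjoint
operator with `D(A) = D(Q)` and `Q(u) = ‖A u‖²`, then the generator is `A ∘ A`. -/
theorem generator_eq_sq (Q : DirichletForm m) (A : Ell2 m →ₗ.[ℂ] Ell2 m)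
    (hA : IsSelfAdjoint A) (hd : A.domain = Q.domain)
    (hq : ∀ u : Q.domain, Q.quad u = ‖A ⟨u, hd.ge u.2⟩‖ ^ 2) (u f : Ell2 m) :
    (u, f) ∈ Q.generator.graph ↔
      ∃ (h : u ∈ A.domain) (h' : A ⟨u, h⟩ ∈ A.domain), A ⟨_, h'⟩ = f := by
  have hAd := hA.dense_domain
  have hA' : A.adjoint = A := hA
  rw [generator_graph]
  have hfe := Q.form_eq (A.toFun ∘ₗ Submodule.inclusion hd.ge) hq
  constructor
  · rintro ⟨h, hf⟩
    have hu : u ∈ A.domain := hd ▸ h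
    have e : ∀ x : A.domain, ⟪f, (x : Ell2 m)⟫_ℂ = ⟪A ⟨u, hu⟩, A x⟫_ℂ := fun x => by
      have := hf ⟨x, hd ▸ x.2⟩
      rw [hfe] at this
      rw [← inner_conj_symm, ← inner_conj_symm (A ⟨u, hu⟩)]
      exact congrArg _ this.symm
    have h1 := A.mem_adjoint_domain_of_exists (A ⟨u, hu⟩) ⟨f, e⟩
    have h2 := LinearPMap.adjoint_apply_eq hAd ⟨_, h1⟩ e
    have h3 : A ⟨u, hu⟩ ∈ A.domain := hA'.le.1 h1
    refine ⟨hu, h3, ?_⟩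
    rw [← h2]
    exact (hA'.le.2 (x := ⟨_, h1⟩) (y := ⟨_, h3⟩) rfl).symm
  · rintro ⟨h, h', rfl⟩
    refine ⟨hd ▸ h, fun v => ?_⟩
    rw [hfe]
    have hs := LinearPMap.adjoint_isFormalAdjoint (T := A) hAd
    rw [hA'] at hs
    exact (hs ⟨v, hd.ge v.2⟩ ⟨_, h'⟩)

/-- If a Sobolev inequality holds, the minimal constant exists and is the Sobolev constant. -/
theorem isLeast_sobolevConstant [Countable X] [DiscreteMeasurableSpace X] (hm : ∀ x, 0 < m x)
    (Q : DirichletForm m) (p : ℝ≥0∞) (hp : p ≠ 0) {α : ℝ} (hα : 0 ≤ α) (o : X)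
    (hQ : Q.SobolevInequality p α o) :
    IsLeast {S : ℝ | Q.IsSobolevBound p α o S} (Q.sobolevConstant p α o) := by
  refine (fun hc hb => ⟨IsClosed.csInf_mem (s := {S : ℝ | Q.IsSobolevBound p α o S}) hc hQ hb, fun S hS => csInf_le hb hS⟩ : IsClosed {S : ℝ | Q.IsSobolevBound p α o S} → BddBelow {S : ℝ | Q.IsSobolevBound p α o S} → _) ?_ ?_
  · have : {S : ℝ | Q.IsSobolevBound p α o S} = ⋂ u : Q.domain, {S | eLpNorm (u : Ell2 m) p (weightMeasure m) ^ 2 ≤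
    ENNReal.ofReal (S * (Q.quad u + α * ‖(u : Ell2 m) o‖ ^ 2))} := by
      ext; simp [IsSobolevBound]
    rw [this]
    refine isClosed_iInter fun u => isClosed_le continuous_const ?_
    exact ENNReal.continuous_ofReal.comp (by fun_prop)
  
  refine ⟨0, fun S hS => ?_⟩
  by_contra hneg
  push Not at hneg
  have hzero : ∀ u : Q.domain, (u : Ell2 m) = 0 := fun u => by
    have h := hS u
    have : S * (Q.quad u + α * ‖(u : Ell2 m) o‖ ^ 2) ≤ 0 :=
      mul_nonpos_of_nonpos_of_nonneg hneg.le (add_nonneg (Q.nonneg u) (by positivity))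
    rw [ENNReal.ofReal_of_nonpos this] at h
    have h' : eLpNorm (u : Ell2 m) p (weightMeasure m) = 0 := by simpa using h
    exact (Lp.eq_zero_iff_ae_eq_zero).2 ((eLpNorm_eq_zero_iff (Lp.aestronglyMeasurable _) hp).1 h')
  have hall : ∀ f : Ell2 m, f = 0 := fun f =>
    Q.dense.eq_zero_of_inner_right ℂ (fun v hv => by rw [show v = 0 from hzero ⟨v, hv⟩, inner_zero_left])
  have hmo : weightMeasure m {o} = ENNReal.ofReal (m o) := by
    rw [weightMeasure, Measure.sum_apply _ (MeasurableSet.singleton o), tsum_eq_single o]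
    · simp
    · intro b hb; simp [hb]
  have := hall (indicatorConstLp 2 (MeasurableSet.singleton o) (by rw [hmo]; simp) 1)
  have h2 := norm_indicatorConstLp (p := 2) (c := (1 : ℂ)) (μ := weightMeasure m) (hs := MeasurableSet.singleton o) (hμs := by rw [hmo]; simp) (by simp) (by simp)
  rw [this] at h2
  simp [Measure.real, hmo, ENNReal.toReal_ofReal (hm o).le] at h2
  exact absurd h2 (by have := hm o; positivity)

end DirichletForm

/-! ### Spectral notions for unbounded operators -/

section Spectral

variable {H : Type*} [NormedAddCommGroup H] [NormedSpace ℂ H]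

/-- The spectrum of `T`: the complex numbers `z` for which `T - z : D(T) → H` does not have a bounded
everywhere defined inverse `R`. -/
def operatorSpectrum (T : H →ₗ.[ℂ] H) : Set ℂ :=
  {z | ¬ ∃ R : H →L[ℂ] H, (∀ f, ∃ h : R f ∈ T.domain, T ⟨R f, h⟩ - z • R f = f) ∧
    ∀ u : T.domain, R (T u - z • (u : H)) = u}

/-- The eigenspace `{u ∈ D(T) | T u = z u}`. -/
def eigenspace (T : H →ₗ.[ℂ] H) (z : ℂ) : Submodule ℂ H :=
  (LinearMap.ker (T.toFun - z • T.domain.subtype)).map T.domain.subtype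

/-- Purely discrete spectrum: every point of the spectrum is an isolated point of the spectrum and an
eigenvalue of finite multiplicity. -/
def HasPurelyDiscreteSpectrum (T : H →ₗ.[ℂ] H) : Prop :=
  ∀ z ∈ operatorSpectrum T, ¬ AccPt z (𝓟 (operatorSpectrum T)) ∧
    eigenspace T z ≠ ⊥ ∧ FiniteDimensional ℂ (eigenspace T z)

/-- `lam 1 ≤ lam 2 ≤ ⋯` (with indices `1 ≤ k ≤ N`, or all `k ≥ 1` if `N = ∞`) is the list of all
eigenvalues of `T` in nondecreasing order, each repeated according to its multiplicity.  These
properties determine `lam k` for `1 ≤ k ≤ N`. -/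
structure IsEigenvalueEnumeration (T : H →ₗ.[ℂ] H) (N : ℕ∞) (lam : ℕ → ℝ) : Prop where
  mono : ∀ i j : ℕ, 1 ≤ i → i ≤ j → (j : ℕ∞) ≤ N → lam i ≤ lam j
  multiplicity : ∀ z : ℂ, {k : ℕ | 1 ≤ k ∧ (k : ℕ∞) ≤ N ∧ (lam k : ℂ) = z}.encard =
    Cardinal.toENat (Module.rank ℂ (eigenspace T z))

end Spectral

end DiscreteDirichlet

end

/-! Since `m o * |u(o)|²` is at most `‖u‖²`, the Sobolev inequality gives `‖u‖_∞² ≤ S (Q(u) + (α / m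
o) ‖u‖²)`. This estimate is used twice. Discreteness: the form domain, a Hilbert space under `Q(u,
v) + ⟨u, v⟩`, embeds boundedly into `ℓ^∞`. As `m(X)` is finite, its inclusion `J` into `ℓ²` is a
norm limit of truncations to finite sets, hence compact. So `(L + 1)⁻¹ = J J*` is compact, symmetric
and injective, and its spectral theory transfers to `L` (`isCompactOperator_of_norm_apply_le`,
`mem_generatorGraph_iff`). Lower bound: let `v₁, …, v_k` be orthonormal eigenfunctions with
eigenvalues at most `t`. Then `u = ∑ cᵢ vᵢ` has `Q(u) ≤ t ∑ |cᵢ|²`, so `|u(x)|² ≤ B ∑ |cᵢ|²` with `B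
= S (t + α / m o)`. Taking `cᵢ` conjugate to `vᵢ(x)` yields `∑ |vᵢ(x)|² ≤ B`; integrating in `x`
gives `k ≤ B m(X)` (`card_le_of_norm_apply_le`, `card_le_of_sobolevBound`). Put `t = λ_k`. -/

noncomputable section

namespace DiscreteDirichlet

/-! ### Functions in `ℓ²(X, m)` and consequences of `ℓ^∞` bounds -/

section Ell2Basics

variable {X : Type*} [MeasurableSpace X] {m : X → ℝ}

theorem integrable_norm_sq (u : Ell2 m) : Integrable (fun x => ‖u x‖ ^ 2) (weightMeasure m) :=
  (memLp_two_iff_integrable_sq_norm (Lp.aestronglyMeasurable u)).1 (Lp.memLp u)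

theorem norm_sq_eq_integral (u : Ell2 m) : ‖u‖ ^ 2 = ∫ x, ‖u x‖ ^ 2 ∂weightMeasure m := by
  have h : (⟪u, u⟫_ℂ) = ((∫ x, ‖u x‖ ^ 2 ∂weightMeasure m : ℝ) : ℂ) := by
    rw [L2.inner_def, ← integral_complex_ofReal]
    refine integral_congr_ae (Eventually.of_forall fun x => ?_)
    simp [inner_self_eq_norm_sq_to_K]
  rw [inner_self_eq_norm_sq_to_K] at h
  exact Complex.ofReal_injective ((Complex.ofReal_pow _ 2).trans h)

variable [DiscreteMeasurableSpace X]

theorem weightMeasure_singleton (m : X → ℝ) (x : X) :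
    weightMeasure m {x} = ENNReal.ofReal (m x) := by
  rw [weightMeasure, Measure.sum_apply _ (MeasurableSet.singleton x), tsum_eq_single x]
  · simp
  · intro b hb; simp [hb]

/-- Points have positive mass, so only the empty set is null; almost-everywhere identities of
representatives become pointwise ones. -/
theorem ae_weightMeasure_iff (hm : ∀ x, 0 < m x) {p : X → Prop} :
    (∀ᵐ x ∂weightMeasure m, p x) ↔ ∀ x, p x := by
  refine ⟨fun h x => ?_, fun h => Eventually.of_forall h⟩
  by_contra hx
  have h0 : weightMeasure m {x} = 0 :=
    measure_mono_null (fun y (hy : y = x) => by simpa [hy] using hx) (ae_iff.1 h)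
  rw [weightMeasure_singleton, ENNReal.ofReal_eq_zero] at h0
  exact absurd (hm x) (not_lt.2 h0)

/-- For strictly positive `m`, evaluation identifies `ℓ²(X, m)` with a space of functions. -/
def evalLinear (hm : ∀ x, 0 < m x) : Ell2 m →ₗ[ℂ] (X → ℂ) where
  toFun u := u
  map_add' u v := funext ((ae_weightMeasure_iff hm).1 (Lp.coeFn_add u v))
  map_smul' c u := funext ((ae_weightMeasure_iff hm).1 (Lp.coeFn_smul c u))

theorem evalLinear_apply (hm : ∀ x, 0 < m x) (u : Ell2 m) (x : X) : evalLinear hm u x = u x := rfl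

theorem sum_smul_apply (hm : ∀ x, 0 < m x) {ι : Type*} (F : Finset ι) (c : ι → ℂ) (v : ι → Ell2 m)
    (x : X) : (∑ i ∈ F, c i • v i : Ell2 m) x = ∑ i ∈ F, c i * v i x := by
  rw [← evalLinear_apply hm, map_sum, Finset.sum_apply]
  exact Finset.sum_congr rfl fun i _ => by rw [map_smul]; rfl

theorem evalLinear_injective (hm : ∀ x, 0 < m x) : Function.Injective (evalLinear hm) :=
  fun _ _ h => Lp.ext (Eventually.of_forall (congrFun h))

theorem weight_mul_norm_sq_le (hm : ∀ x, 0 < m x) (u : Ell2 m) (x : X) :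
    m x * ‖u x‖ ^ 2 ≤ ‖u‖ ^ 2 := by
  rw [norm_sq_eq_integral]
  have h := setIntegral_le_integral (s := {x}) (integrable_norm_sq u)
    (Eventually.of_forall fun y => by positivity)
  rwa [integral_singleton, Measure.real, weightMeasure_singleton,
    ENNReal.toReal_ofReal (hm x).le, smul_eq_mul] at h

/-- The indicator function of a point. -/
def delta (m : X → ℝ) (x : X) : Ell2 m :=
  indicatorConstLp 2 (MeasurableSet.singleton x)
    (by rw [weightMeasure_singleton]; exact ENNReal.ofReal_ne_top) (1 : ℂ)

open Classical in
theorem delta_apply (hm : ∀ x, 0 < m x) (x y : X) : delta m x y = if y = x then 1 else 0 := by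
  have h := (ae_weightMeasure_iff hm).1 (indicatorConstLp_coeFn (p := 2) (μ := weightMeasure m)
    (hs := MeasurableSet.singleton x)
    (hμs := by rw [weightMeasure_singleton]; exact ENNReal.ofReal_ne_top) (c := (1 : ℂ))) y
  rw [delta, h]
  simp [Set.indicator_apply]

theorem inner_delta (hm : ∀ x, 0 < m x) (x : X) (u : Ell2 m) : ⟪delta m x, u⟫_ℂ = m x * u x := by
  rw [delta, L2.inner_indicatorConstLp_one, integral_singleton, Measure.real,
    weightMeasure_singleton, ENNReal.toReal_ofReal (hm x).le, Complex.real_smul]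

/-- Restriction of functions to a finite set, as an operator of finite rank. -/
def truncation (m : X → ℝ) (F : Finset X) : Ell2 m →L[ℂ] Ell2 m :=
  ∑ x ∈ F, (((m x : ℂ)⁻¹ • innerSL ℂ (delta m x)).smulRight (delta m x))

open Classical in
theorem truncation_apply (hm : ∀ x, 0 < m x) (F : Finset X) (u : Ell2 m) (y : X) :
    truncation m F u y = if y ∈ F then u y else 0 := by
  have hmc : ∀ x, (m x : ℂ) ≠ 0 := fun x => by exact_mod_cast (hm x).ne'
  have h : truncation m F u = ∑ x ∈ F, u x • delta m x := by
    simp [truncation, inner_delta hm, hmc]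
  rw [h, sum_smul_apply hm]
  simp [delta_apply hm]

theorem isCompactOperator_truncation (m : X → ℝ) (F : Finset X) :
    IsCompactOperator (truncation m F) := by
  refine Submodule.sum_mem (compactOperator (RingHom.id ℂ) (Ell2 m) (Ell2 m)) fun x _ => ?_
  have h : IsCompactOperator (ContinuousLinearMap.toSpanSingleton ℂ (delta m x)) :=
    isCompactOperator_of_locallyCompactSpace_rng _
  exact h.comp_clm ((m x : ℂ)⁻¹ • innerSL ℂ (delta m x))

theorem tendsto_weightMeasure_compl [Countable X] (m : X → ℝ) (hfin : weightMeasure m Set.univ < ∞) :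
    Tendsto (fun F : Finset X => (weightMeasure m).real ((F : Set X)ᶜ)) atTop (𝓝 0) := by
  have h := tendsto_measure_iInter_atTop (μ := weightMeasure m) (s := fun F : Finset X => (F : Set X)ᶜ)
    (fun F => MeasurableSet.nullMeasurableSet .of_discrete)
    (fun F G hFG => Set.compl_subset_compl.2 (Finset.coe_subset.2 hFG))
    ⟨∅, ((measure_mono (Set.subset_univ _)).trans_lt hfin).ne⟩
  have h0 : (⋂ F : Finset X, (F : Set X)ᶜ) = ∅ :=
    Set.eq_empty_of_forall_notMem fun x hx => by
      simpa using Set.mem_iInter.1 hx {x}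
  rw [h0, measure_empty] at h
  exact (ENNReal.tendsto_toReal ENNReal.zero_ne_top).comp h

/-- An operator into `ℓ²(X, m)` which is bounded as an operator into `ℓ^∞` is compact when `m` is
finite. -/
theorem isCompactOperator_of_norm_apply_le [Countable X] (hm : ∀ x, 0 < m x)
    (hfin : weightMeasure m Set.univ < ∞) {V : Type*} [NormedAddCommGroup V] [NormedSpace ℂ V]
    (J : V →L[ℂ] Ell2 m) {C : ℝ} (hC : 0 ≤ C) (hJ : ∀ v x, ‖J v x‖ ^ 2 ≤ C * ‖v‖ ^ 2) :
    IsCompactOperator J := by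
  have : IsFiniteMeasure (weightMeasure m) := ⟨hfin⟩
  -- The error vanishes on `F` and is pointwise at most `√C ‖v‖` off `F`; only the mass of the
  -- complement enters.
  have hb : ∀ F : Finset X, ‖truncation m F ∘L J - J‖ ≤
      √((weightMeasure m).real ((F : Set X)ᶜ) * C) := fun F => by
    refine ContinuousLinearMap.opNorm_le_bound _ (Real.sqrt_nonneg _) fun v => ?_
    refine (sq_le_sq₀ (norm_nonneg _) (by positivity)).1 ?_
    rw [mul_pow, Real.sq_sqrt (by positivity), norm_sq_eq_integral, mul_assoc, ← smul_eq_mul,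
      ← setIntegral_const, ← integral_indicator .of_discrete]
    refine integral_mono (integrable_norm_sq _)
      ((integrable_const _).indicator .of_discrete) fun x => ?_
    have h : (truncation m F ∘L J - J) v x = truncation m F (J v) x - J v x := by
      simp only [← evalLinear_apply hm, sub_apply, map_sub, Pi.sub_apply]
      rfl
    classical
    simp only [h, truncation_apply hm]
    by_cases hx : x ∈ F
    · simp [hx]
    · simpa [hx] using hJ v x
  refine isCompactOperator_of_tendsto (l := atTop) (F := fun F : Finset X => truncation m F ∘L J) ?_
    (Eventually.of_forall fun F => (isCompactOperator_truncation m F).comp_clm J)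
  rw [tendsto_iff_norm_sub_tendsto_zero]
  refine squeeze_zero (fun _ => norm_nonneg _) hb ?_
  have := ((tendsto_weightMeasure_compl m hfin).mul_const C).sqrt
  simpa using this

/-- The number of elements of an orthonormal system is controlled by the norm of the embedding of
its span into `ℓ^∞`. -/
theorem card_le_of_norm_apply_le (hm : ∀ x, 0 < m x) (hfin : weightMeasure m Set.univ < ∞)
    {ι : Type*} {v : ι → Ell2 m} (hv : Orthonormal ℂ v) (F : Finset ι) {B : ℝ} (hB : 0 ≤ B)
    (h : ∀ (c : ι → ℂ) x, ‖(∑ i ∈ F, c i • v i : Ell2 m) x‖ ^ 2 ≤ B * ∑ i ∈ F, ‖c i‖ ^ 2) :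
    (F.card : ℝ) ≤ B * (weightMeasure m).real Set.univ := by
  have : IsFiniteMeasure (weightMeasure m) := ⟨hfin⟩
  have hpt : ∀ x, ∑ i ∈ F, ‖v i x‖ ^ 2 ≤ B := fun x => by
    -- With these coefficients the combination takes the value `T = ∑ ‖v i x‖ ^ 2` at `x`, so the
    -- hypothesis reads `T² ≤ B T`, whence `T ≤ B`.
    have h1 := h (fun i => starRingEnd ℂ (v i x)) x
    have h2 : (∑ i ∈ F, starRingEnd ℂ (v i x) • v i : Ell2 m) x =
        ((∑ i ∈ F, ‖v i x‖ ^ 2 : ℝ) : ℂ) := by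
      rw [sum_smul_apply hm]
      simp [Complex.conj_mul']
    have h0 : 0 ≤ ∑ i ∈ F, ‖v i x‖ ^ 2 := by positivity
    rw [h2, Complex.norm_real, Real.norm_of_nonneg h0] at h1
    simp only [RCLike.norm_conj] at h1
    nlinarith
  calc (F.card : ℝ) = ∑ i ∈ F, ‖v i‖ ^ 2 := by simp [hv.1]
    _ = ∫ x, ∑ i ∈ F, ‖v i x‖ ^ 2 ∂weightMeasure m := by
      rw [integral_finsetSum _ fun i _ => integrable_norm_sq _]
      exact Finset.sum_congr rfl fun i _ => norm_sq_eq_integral _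
    _ ≤ ∫ _, B ∂weightMeasure m :=
      integral_mono (integrable_finsetSum _ fun i _ => integrable_norm_sq _) (integrable_const _) hpt
    _ = B * (weightMeasure m).real Set.univ := by simp [mul_comm]

theorem linearIndependent_delta (hm : ∀ x, 0 < m x) : LinearIndependent ℂ (delta m) := by
  classical
  refine LinearIndependent.of_comp (evalLinear hm) ?_
  have : evalLinear hm ∘ delta m = fun x => Pi.single x (1 : ℂ) := by
    ext x y
    simp [evalLinear_apply, delta_apply hm, Pi.single_apply]
  rw [this]
  exact Pi.linearIndependent_single_one X ℂ

theorem finite_of_finiteDimensional (hm : ∀ x, 0 < m x) [FiniteDimensional ℂ (Ell2 m)] :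
    Finite X := (linearIndependent_delta hm).finite_of_isNoetherian

theorem finrank_ell2 (hm : ∀ x, 0 < m x) [Finite X] :
    FiniteDimensional ℂ (Ell2 m) ∧ Module.finrank ℂ (Ell2 m) = Nat.card X := by
  have := Fintype.ofFinite X
  have : FiniteDimensional ℂ (Ell2 m) :=
    FiniteDimensional.of_injective _ (evalLinear_injective hm)
  refine ⟨this, le_antisymm ?_ ?_⟩
  · simpa using LinearMap.finrank_le_finrank_of_injective (evalLinear_injective hm)
  · simpa using (linearIndependent_delta hm).fintype_card_le_finrank

end Ell2Basics

namespace DirichletForm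

/-! ### The form Hilbert space, the resolvent and the eigenspaces -/

section FormDomain

variable {X : Type*} [MeasurableSpace X] {m : X → ℝ}

/-- The form domain, to be equipped with the form inner product `Q(u, v) + ⟨u, v⟩`. -/
def FormDomain (Q : DirichletForm m) : Type _ := Q.domain

variable (Q : DirichletForm m)

instance : AddCommGroup Q.FormDomain := inferInstanceAs (AddCommGroup Q.domain)

instance : Module ℂ Q.FormDomain := inferInstanceAs (Module ℂ Q.domain)

/-- The inclusion of the form domain into `ℓ²`. -/
def inclLinear : Q.FormDomain →ₗ[ℂ] Ell2 m := Q.domain.subtype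

/-- The sesquilinear form on `Q.FormDomain`. -/
def formOn : Q.FormDomain →ₗ⋆[ℂ] Q.FormDomain →ₗ[ℂ] ℂ := Q.form

/-- The form inner product. -/
@[reducible] def formCore : InnerProductSpace.Core ℂ Q.FormDomain where
  inner u v := Q.formOn u v + ⟪Q.inclLinear u, Q.inclLinear v⟫_ℂ
  conj_inner_symm u v := by
    rw [map_add, inner_conj_symm]
    exact congrArg (· + _) (Q.hermitian u v).symm
  re_inner_nonneg u := by
    rw [map_add]
    exact add_nonneg (Q.nonneg u) inner_self_nonneg
  add_left u v w := by simp only [map_add, LinearMap.add_apply, inner_add_left]; ring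
  smul_left u v r := by
    simp only [map_smulₛₗ, LinearMap.smul_apply, inner_smul_left, smul_eq_mul, RingHom.id_apply]
    ring
  definite u hu := by
    have h := congrArg Complex.re hu
    rw [Complex.add_re, Complex.zero_re] at h
    have h1 : 0 ≤ (Q.formOn u u).re := Q.nonneg u
    have h2 : 0 ≤ (⟪Q.inclLinear u, Q.inclLinear u⟫_ℂ).re := inner_self_nonneg (𝕜 := ℂ)
    have h3 : (⟪Q.inclLinear u, Q.inclLinear u⟫_ℂ).re = 0 := by linarith
    have h4 : Q.inclLinear u = 0 := by
      rw [← norm_eq_zero, ← sq_eq_zero_iff, ← inner_self_eq_norm_sq (𝕜 := ℂ)]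
      exact h3
    exact Subtype.ext h4

/-- The synonym keeps this norm apart from the `ℓ²` norm that `Q.domain` inherits as a subspace. -/
instance : NormedAddCommGroup Q.FormDomain := Q.formCore.toNormedAddCommGroup

instance : InnerProductSpace ℂ Q.FormDomain := InnerProductSpace.ofCore Q.formCore.toCore

theorem inner_formDomain (u v : Q.FormDomain) :
    ⟪u, v⟫_ℂ = Q.formOn u v + ⟪Q.inclLinear u, Q.inclLinear v⟫_ℂ := rfl

theorem norm_sq_formDomain (u : Q.FormDomain) :
    ‖u‖ ^ 2 = Q.quad u + ‖Q.inclLinear u‖ ^ 2 := by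
  rw [← inner_self_eq_norm_sq (𝕜 := ℂ), inner_formDomain, map_add, inner_self_eq_norm_sq]
  rfl

/-- The inclusion of the form domain into `ℓ²` as a bounded operator. -/
def incl : Q.FormDomain →L[ℂ] Ell2 m :=
  Q.inclLinear.mkContinuous 1 fun u => by
    rw [one_mul]
    refine (sq_le_sq₀ (norm_nonneg _) (norm_nonneg _)).1 ?_
    rw [norm_sq_formDomain]
    exact le_add_of_nonneg_left (Q.nonneg u)

theorem incl_mem (u : Q.FormDomain) : Q.incl u ∈ Q.domain := Subtype.prop (p := (· ∈ Q.domain)) u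

/-- This is closedness of `Q`: a Cauchy sequence for the form norm is Cauchy both in `ℓ²` and for
`Q`. Completeness is needed for the adjoint of `incl`. -/
instance : CompleteSpace Q.FormDomain := by
  refine Metric.complete_of_cauchySeq_tendsto fun u hu => ?_
  obtain ⟨f, hf⟩ := cauchySeq_tendsto_of_complete (Q.incl.uniformContinuous.comp_cauchySeq hu)
  have hq : ∀ ε > 0, ∃ N, ∀ i ≥ N, ∀ j ≥ N, Q.quad (u i - u j : Q.FormDomain) < ε := fun ε hε => by
    obtain ⟨N, hN⟩ := Metric.cauchySeq_iff.1 hu (√ε) (Real.sqrt_pos.2 hε)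
    refine ⟨N, fun i hi j hj => ?_⟩
    have h := hN i hi j hj
    rw [dist_eq_norm, Real.lt_sqrt (norm_nonneg _), norm_sq_formDomain] at h
    have := sq_nonneg ‖Q.inclLinear (u i - u j)‖
    linarith
  obtain ⟨hfd, ht⟩ := Q.closed u f hf hq
  let g : Q.FormDomain := (⟨f, hfd⟩ : Q.domain)
  refine ⟨g, ?_⟩
  rw [tendsto_iff_norm_sub_tendsto_zero]
  have h2 : Tendsto (fun n => ‖Q.incl (u n) - f‖ ^ 2) atTop (𝓝 0) := by
    simpa using (tendsto_iff_norm_sub_tendsto_zero.1 hf).pow 2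
  have h3 : Tendsto (fun n => ‖u n - g‖ ^ 2) atTop (𝓝 0) := by
    have := ht.add h2
    rw [add_zero] at this
    refine this.congr fun n => ?_
    rw [norm_sq_formDomain, map_sub]
    rfl
  simpa [Real.sqrt_sq] using h3.sqrt

/-- The resolvent `(L + 1)⁻¹`. -/
def resolventOp : Ell2 m →L[ℂ] Ell2 m := Q.incl ∘L ContinuousLinearMap.adjoint Q.incl

theorem isSymmetric_resolventOp : (Q.resolventOp : Ell2 m →ₗ[ℂ] Ell2 m).IsSymmetric := fun u v => by
  change ⟪Q.incl (ContinuousLinearMap.adjoint Q.incl u), v⟫_ℂ =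
    ⟪u, Q.incl (ContinuousLinearMap.adjoint Q.incl v)⟫_ℂ
  rw [← ContinuousLinearMap.adjoint_inner_right, ContinuousLinearMap.adjoint_inner_left]

/-- Adding `⟨v, u⟩` to both sides of `Q(v, u) = ⟨v, f⟩` gives `⟨v, u⟩_Q = ⟨J v, f + u⟩`, that is, `u
= J* (f + u)` in the form domain. -/
theorem mem_generatorGraph_iff (u f : Ell2 m) :
    (u, f) ∈ Q.generatorGraph ↔ Q.resolventOp (f + u) = u := by
  constructor
  · rintro ⟨h, hf⟩
    let u' : Q.FormDomain := (⟨u, h⟩ : Q.domain)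
    have hu : ContinuousLinearMap.adjoint Q.incl (f + u) = u' := by
      refine ext_inner_left ℂ fun v => ?_
      rw [ContinuousLinearMap.adjoint_inner_right, inner_formDomain, inner_add_right]
      exact congrArg (· + _) (hf v).symm
    rw [resolventOp, ContinuousLinearMap.comp_apply, hu]
    rfl
  · intro h
    set w := ContinuousLinearMap.adjoint Q.incl (f + u) with hw
    have hwu : Q.incl w = u := h
    refine ⟨hwu ▸ Q.incl_mem w, fun v => ?_⟩
    let v' : Q.FormDomain := v
    have h1 : ⟪v', w⟫_ℂ = ⟪Q.incl v', f + u⟫_ℂ := by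
      rw [hw, ContinuousLinearMap.adjoint_inner_right]
    rw [inner_formDomain, inner_add_right] at h1
    have h2 : Q.inclLinear w = u := hwu
    rw [h2] at h1
    have h3 := add_right_cancel h1
    have h4 : w = (⟨u, hwu ▸ Q.incl_mem w⟩ : Q.domain) := Subtype.ext h2
    rw [h4] at h3
    exact h3

theorem resolventOp_injective : Function.Injective Q.resolventOp := by
  refine (injective_iff_map_eq_zero Q.resolventOp).2 fun f hf => ?_
  have h : ((0 : Ell2 m), f) ∈ Q.generatorGraph := by
    rw [mem_generatorGraph_iff, add_zero, hf]
  obtain ⟨h0, hv⟩ := h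
  refine Q.dense.eq_zero_of_inner_right ℂ fun v hvd => ?_
  rw [← hv ⟨v, hvd⟩]
  exact map_zero (Q.form ⟨v, hvd⟩)

theorem mem_generator_eigenspace_iff (z : ℂ) (u : Ell2 m) :
    u ∈ eigenspace Q.generator z ↔ (u, z • u) ∈ Q.generatorGraph := by
  rw [← generator_graph, LinearPMap.mem_graph_iff, eigenspace, Submodule.mem_map]
  refine exists_congr fun y => ?_
  rw [LinearMap.mem_ker, LinearMap.sub_apply, sub_eq_zero, and_comm]
  refine and_congr_right fun h => ?_
  rw [← h]
  rfl

theorem mem_generator_eigenspace_iff_resolventOp (z : ℂ) (u : Ell2 m) :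
    u ∈ eigenspace Q.generator z ↔ (z + 1) • Q.resolventOp u = u := by
  rw [mem_generator_eigenspace_iff, mem_generatorGraph_iff, ← map_smul, add_smul, one_smul]

/-- If `L v = w v`, then `Q(u, v) = w ⟨u, v⟩` for all `u` in the form domain. -/
theorem form_of_mem_eigenspace {w : ℂ} {v : Ell2 m} (hv : v ∈ eigenspace Q.generator w) :
    ∃ h : v ∈ Q.domain, ∀ u : Q.domain, Q.form u ⟨v, h⟩ = w * ⟪(u : Ell2 m), v⟫_ℂ := by
  obtain ⟨h, hf⟩ := (Q.mem_generator_eigenspace_iff w v).1 hv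
  exact ⟨h, fun u => by rw [hf u, inner_smul_right]⟩

theorem re_nonneg_of_mem_eigenspace {z : ℂ} {u : Ell2 m} (hu : u ∈ eigenspace Q.generator z)
    (h0 : u ≠ 0) : 0 ≤ z.re ∧ z.im = 0 := by
  obtain ⟨h, hf⟩ := Q.form_of_mem_eigenspace hu
  have hp : 0 < ‖u‖ ^ 2 := by positivity
  have h1 : Q.form ⟨u, h⟩ ⟨u, h⟩ = z * ((‖u‖ ^ 2 : ℝ) : ℂ) := by
    rw [hf, inner_self_eq_norm_sq_to_K]
    exact congrArg (z * ·) (Complex.ofReal_pow ‖u‖ 2).symm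
  have hre := congrArg Complex.re h1
  have him := congrArg Complex.im h1
  rw [Complex.re_mul_ofReal] at hre
  rw [Complex.im_mul_ofReal] at him
  have hn := Q.nonneg ⟨u, h⟩
  have hs := congrArg Complex.im (Q.hermitian ⟨u, h⟩ ⟨u, h⟩)
  rw [Complex.conj_im, him] at hs
  rw [hre] at hn
  refine ⟨nonneg_of_mul_nonneg_left hn hp, ?_⟩
  have : z.im * ‖u‖ ^ 2 = 0 := by linarith
  exact (mul_eq_zero.1 this).resolve_right hp.ne'

theorem eigenspace_eq_bot_of_ne {z : ℂ} (hz : ((z.re : ℝ) : ℂ) ≠ z) :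
    eigenspace Q.generator z = ⊥ := by
  rw [Submodule.eq_bot_iff]
  intro u hu
  by_contra h0
  exact hz (Complex.ext (by simp) (by simp [(Q.re_nonneg_of_mem_eigenspace hu h0).2]))

/-- Evaluating `Q(u, v)` from either argument gives `ν ⟨u, v⟩ = μ ⟨u, v⟩`. -/
theorem orthogonalFamily_eigenspace :
    OrthogonalFamily ℂ (fun μ : ℝ => eigenspace Q.generator (μ : ℂ))
      fun μ => (eigenspace Q.generator (μ : ℂ)).subtypeₗᵢ := by
  intro μ ν hμν ⟨u, hu⟩ ⟨v, hv⟩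
  change ⟪u, v⟫_ℂ = 0
  obtain ⟨hud, hu'⟩ := Q.form_of_mem_eigenspace hu
  obtain ⟨hvd, hv'⟩ := Q.form_of_mem_eigenspace hv
  have h1 := Q.hermitian ⟨u, hud⟩ ⟨v, hvd⟩
  rw [hv', hu', map_mul, inner_conj_symm, Complex.conj_ofReal, ← sub_eq_zero, ← sub_mul] at h1
  refine (mul_eq_zero.1 h1).resolve_left ?_
  rw [sub_eq_zero]
  exact_mod_cast hμν.symm

/-- By the spectral theorem the eigenvectors of the compact resolvent are total. Injectivity
excludes the eigenvalue `0`; any other `κ` corresponds to the eigenvalue `κ⁻¹ - 1` of `L`, which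
must be real. -/
theorem iSup_eigenspace_orthogonal (hK : IsCompactOperator Q.resolventOp) :
    (⨆ μ : ℝ, eigenspace Q.generator (μ : ℂ))ᗮ = ⊥ := by
  rw [← le_bot_iff, ← ContinuousLinearMap.orthogonalComplement_iSup_eigenspaces_eq_bot hK
    Q.isSymmetric_resolventOp]
  refine Submodule.orthogonal_le (iSup_le fun κ u hu => ?_)
  rw [Module.End.mem_eigenspace_iff] at hu
  have hu' : Q.resolventOp u = κ • u := hu
  by_cases hκ : κ = 0
  · rw [hκ, zero_smul] at hu'
    rw [(injective_iff_map_eq_zero _).1 Q.resolventOp_injective u hu']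
    exact Submodule.zero_mem _
  · have hmem : u ∈ eigenspace Q.generator (κ⁻¹ - 1) := by
      rw [mem_generator_eigenspace_iff_resolventOp, hu', sub_add_cancel, smul_smul,
        inv_mul_cancel₀ hκ, one_smul]
    by_cases hz : (((κ⁻¹ - 1).re : ℝ) : ℂ) = κ⁻¹ - 1
    · rw [← hz] at hmem
      exact Submodule.mem_iSup_of_mem _ hmem
    · rw [Q.eigenspace_eq_bot_of_ne hz, Submodule.mem_bot] at hmem
      rw [hmem]
      exact Submodule.zero_mem _

/-- If `(L + 1)⁻¹` is compact, then all points of the spectrum are eigenvalues. -/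
theorem eigenspace_ne_bot_of_mem_spectrum (hK : IsCompactOperator Q.resolventOp) {z : ℂ}
    (hz : z ∈ operatorSpectrum Q.generator) : eigenspace Q.generator z ≠ ⊥ := by
  intro hbot
  -- With `K = (L + 1)⁻¹` one has `L - z = (1 - (z + 1) K)(L + 1)`, so inverting the first factor
  -- inverts `L - z`. The Fredholm alternative for `K` makes that factor invertible.
  have hunit : IsUnit (1 - (z + 1) • Q.resolventOp) := by
    by_cases hw : z + 1 = 0
    · simp [hw]
    have hev := hK.hasEigenvalue_or_mem_resolventSet (inv_ne_zero hw)
    rcases hev with hev | hev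
    · obtain ⟨u, hu⟩ := hev.exists_hasEigenvector
      refine absurd ?_ hu.2
      have h1 : Q.resolventOp u = (z + 1)⁻¹ • u := hu.apply_eq_smul
      rw [← Submodule.mem_bot ℂ, ← hbot, mem_generator_eigenspace_iff_resolventOp, h1,
        smul_inv_smul₀ hw]
    · rw [spectrum.mem_resolventSet_iff] at hev
      have h2 : 1 - (z + 1) • Q.resolventOp =
          (Units.mk0 (z + 1) hw) • (algebraMap ℂ (Ell2 m →L[ℂ] Ell2 m) (z + 1)⁻¹ - Q.resolventOp) := by
        rw [Units.smul_mk0, smul_sub, Algebra.algebraMap_eq_smul_one, smul_smul,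
          mul_inv_cancel₀ hw, one_smul]
      rw [h2]
      exact hev.smul _
  obtain ⟨R, hR, hR'⟩ := isUnit_iff_exists.1 hunit
  refine hz ⟨Q.resolventOp ∘L R, fun f => ?_, fun u => ?_⟩
  · set g := R f with hg
    have hgf : g - (z + 1) • Q.resolventOp g = f := congrArg (fun T : Ell2 m →L[ℂ] Ell2 m => T f) hR
    have hmem : (Q.resolventOp g, g - Q.resolventOp g) ∈ Q.generator.graph := by
      rw [generator_graph, mem_generatorGraph_iff, sub_add_cancel]
    obtain ⟨y, hy1, hy2⟩ := (LinearPMap.mem_graph_iff _).1 hmem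
    dsimp only at hy1 hy2
    refine ⟨hy1 ▸ y.2, ?_⟩
    have hy3 : (⟨Q.resolventOp g, hy1 ▸ y.2⟩ : Q.generator.domain) = y := Subtype.ext hy1.symm
    change Q.generator ⟨Q.resolventOp g, _⟩ - z • Q.resolventOp g = f
    rw [hy3, hy2, ← hgf, add_smul, one_smul]
    abel
  · have hmem : ((u : Ell2 m), Q.generator u) ∈ Q.generatorGraph := by
      rw [← generator_graph]
      exact LinearPMap.mem_graph _ u
    rw [mem_generatorGraph_iff] at hmem
    have h1 : Q.generator u - z • (u : Ell2 m) =
        (1 - (z + 1) • Q.resolventOp) (Q.generator u + u) := by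
      change _ = (Q.generator u + u) - (z + 1) • Q.resolventOp (Q.generator u + u)
      rw [hmem, add_smul, one_smul]
      abel
    have h2 : R ((1 - (z + 1) • Q.resolventOp) (Q.generator u + u)) = Q.generator u + u :=
      congrArg (fun T : Ell2 m →L[ℂ] Ell2 m => T (Q.generator u + u)) hR'
    rw [ContinuousLinearMap.comp_apply, h1, h2, hmem]

end FormDomain

end DirichletForm

/-! ### Monotone numbering and assembly of orthonormal bases -/

/-- An index set on which `f` has finite sublevel sets can be numbered by `1, 2, …` so that `f`
becomes nondecreasing. -/
theorem exists_monotone_numbering {ι : Type*} (f : ι → ℝ) (hf : ∀ t, {i | f i ≤ t}.Finite) :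
    ∃ r : ι → ℕ, Function.Injective r ∧
      Set.range r = {k : ℕ | 1 ≤ k ∧ (k : ℕ∞) ≤ ENat.card ι} ∧
      ∀ i j, r i ≤ r j → f i ≤ f j := by
  classical
  -- An arbitrary well-order breaks ties of `f`. The rank below counts the element itself, so
  -- numbering starts at `1`.
  let _ : LinearOrder ι := linearOrderOfSTO WellOrderingRel
  let g : ι → ℝ ×ₗ ι := fun i => toLex (f i, i)
  have hg : Function.Injective g := fun i j h => congrArg (fun p => (ofLex p).2) h
  have hgf : ∀ {i j}, g i ≤ g j → f i ≤ f j := fun {i j} h => by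
    rcases Prod.Lex.toLex_le_toLex.1 h with h | h
    · exact h.le
    · exact h.1.le
  have hfin : ∀ i, {j | g j ≤ g i}.Finite := fun i => (hf (f i)).subset fun j hj => hgf hj
  let r : ι → ℕ := fun i => {j | g j ≤ g i}.ncard
  have hlt : ∀ {i j}, g i < g j → r i < r j := fun {i j} h =>
    Set.ncard_lt_ncard (Set.ssubset_iff_exists.2
      ⟨fun k (hk : g k ≤ g i) => hk.trans h.le, j, le_refl (g j), not_le.2 h⟩) (hfin j)
  have hinj : Function.Injective r := fun i j h => by
    rcases lt_trichotomy (g i) (g j) with h' | h' | h'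
    · exact absurd h (hlt h').ne
    · exact hg h'
    · exact absurd h (hlt h').ne'
  have hmono : ∀ {i j}, r i ≤ r j → g i ≤ g j := fun {i j} h => by
    by_contra h'
    exact absurd h (not_le.2 (hlt (not_le.1 h')))
  have hpos : ∀ i, 1 ≤ r i := fun i =>
    (Set.ncard_pos (hfin i)).2 ⟨i, le_refl (g i)⟩
  have himg : ∀ i, r '' {j | g j ≤ g i} = Set.Icc 1 (r i) := fun i => by
    refine Set.eq_of_subset_of_ncard_le ?_ ?_ (Set.finite_Icc _ _)
    · rintro _ ⟨j, hj, rfl⟩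
      exact ⟨hpos j, Set.ncard_le_ncard (fun k (hk : g k ≤ g j) => hk.trans hj) (hfin i)⟩
    · rw [Set.ncard_image_of_injective _ hinj]
      simp [r, Set.ncard_eq_toFinset_card']
  refine ⟨r, hinj, Set.Subset.antisymm ?_ ?_, fun i j h => hgf (hmono h)⟩
  · rintro _ ⟨i, rfl⟩
    refine ⟨hpos i, ?_⟩
    rw [(hfin i).cast_ncard_eq, ← Set.encard_univ]
    exact Set.encard_le_encard (Set.subset_univ _)
  · rintro k ⟨hk1, hk⟩
    have hex : ∃ i, k ≤ r i := by
      by_contra! hno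
      have h1 : (Set.range r).encard ≤ (Set.Ico 1 k).encard :=
        Set.encard_le_encard (by rintro _ ⟨i, rfl⟩; exact ⟨hpos i, hno i⟩)
      rw [← Set.image_univ, hinj.encard_image, Set.encard_univ] at h1
      have h2 := hk.trans h1
      rw [← (Set.finite_Ico 1 k).cast_ncard_eq, Nat.cast_le, Set.ncard_eq_toFinset_card'] at h2
      simp at h2
      omega
    obtain ⟨i, hi⟩ := hex
    obtain ⟨j, -, hj⟩ := (himg i).ge ⟨hk1, hi⟩
    exact ⟨j, hj⟩

/-- Orthonormal bases of the members of a total orthogonal family of finite-dimensional subspaces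
form a total orthonormal system. -/
theorem _root_.OrthogonalFamily.exists_orthonormal_sigma {H κ : Type*} [NormedAddCommGroup H]
    [InnerProductSpace ℂ H] [CompleteSpace H] {E : κ → Submodule ℂ H}
    [∀ i, FiniteDimensional ℂ (E i)]
    (hE : OrthogonalFamily ℂ (fun i => E i) fun i => (E i).subtypeₗᵢ) (htot : (⨆ i, E i)ᗮ = ⊥) :
    ∃ v : (Σ i, Fin (Module.finrank ℂ (E i))) → H, Orthonormal ℂ v ∧ (∀ a, v a ∈ E a.1) ∧
      (Submodule.span ℂ (Set.range v)).topologicalClosure = ⊤ := by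
  refine ⟨fun a => (stdOrthonormalBasis ℂ (E a.1) a.2 : H), hE.orthonormal_sigma_orthonormal
    fun i => (stdOrthonormalBasis ℂ (E i)).orthonormal, fun a => Subtype.prop _, ?_⟩
  rw [Submodule.topologicalClosure_eq_top_iff, ← le_bot_iff, ← htot]
  refine Submodule.orthogonal_le (iSup_le fun i => ?_)
  have h := congrArg (Submodule.map (E i).subtype) (stdOrthonormalBasis ℂ (E i)).toBasis.span_eq
  rw [Submodule.map_top, Submodule.range_subtype, Submodule.map_span, ← Set.range_comp] at h
  rw [← h]
  refine Submodule.span_mono ?_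
  rintro _ ⟨j, rfl⟩
  exact ⟨⟨i, j⟩, by simp⟩

namespace DirichletForm

/-! ### Consequences of the Sobolev inequality -/

section Sobolev

variable {X : Type*} [MeasurableSpace X] [DiscreteMeasurableSpace X] {m : X → ℝ}

/-- The point value at `o` is absorbed into the `ℓ²` norm. Using `max S 0` avoids deciding the sign
of `S` here. -/
theorem norm_apply_sq_le (hm : ∀ x, 0 < m x) (Q : DirichletForm m) {α : ℝ} (hα : 0 ≤ α) {o : X}
    {S : ℝ} (hS : Q.IsSobolevBound ∞ α o S) (u : Q.domain) (x : X) :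
    ‖(u : Ell2 m) x‖ ^ 2 ≤ max S 0 * (Q.quad u + α / m o * ‖(u : Ell2 m)‖ ^ 2) := by
  have hpos : 0 ≤ Q.quad u + α * ‖(u : Ell2 m) o‖ ^ 2 := add_nonneg (Q.nonneg u) (by positivity)
  have h1 : ‖(u : Ell2 m) x‖ₑ ≤ eLpNorm (u : Ell2 m) ∞ (weightMeasure m) := by
    rw [eLpNorm_exponent_top]
    exact (ae_weightMeasure_iff hm).1 (enorm_ae_le_eLpNormEssSup _ _) x
  have h2 : ENNReal.ofReal (‖(u : Ell2 m) x‖ ^ 2) ≤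
      ENNReal.ofReal (max S 0 * (Q.quad u + α * ‖(u : Ell2 m) o‖ ^ 2)) := by
    rw [ENNReal.ofReal_pow (norm_nonneg _), ofReal_norm]
    exact (pow_le_pow_left' h1 2).trans ((hS u).trans (ENNReal.ofReal_le_ofReal
      (mul_le_mul_of_nonneg_right (le_max_left _ _) hpos)))
  refine ((ENNReal.ofReal_le_ofReal_iff (mul_nonneg (le_max_right _ _) hpos)).1 h2).trans ?_
  refine mul_le_mul_of_nonneg_left (add_le_add_right ?_ _) (le_max_right _ _)
  rw [div_mul_eq_mul_div, le_div_iff₀ (hm o), mul_assoc, mul_comm _ (m o)]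
  exact mul_le_mul_of_nonneg_left (weight_mul_norm_sq_le hm _ _) hα

theorem isCompactOperator_resolventOp [Countable X] (hm : ∀ x, 0 < m x)
    (hfin : weightMeasure m Set.univ < ∞) (Q : DirichletForm m) {α : ℝ} (hα : 0 ≤ α) {o : X}
    {S : ℝ} (hS : Q.IsSobolevBound ∞ α o S) : IsCompactOperator Q.resolventOp := by
  refine (isCompactOperator_of_norm_apply_le hm hfin Q.incl (C := max S 0 * max 1 (α / m o))
    (by positivity) fun u x => ?_).comp_clm (ContinuousLinearMap.adjoint Q.incl)
  refine (Q.norm_apply_sq_le hm hα hS u x).trans ?_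
  rw [mul_assoc]
  refine mul_le_mul_of_nonneg_left ?_ (le_max_right _ _)
  rw [norm_sq_formDomain, mul_add]
  exact add_le_add (le_mul_of_one_le_left (Q.nonneg u) (le_max_left _ _))
    (mul_le_mul_of_nonneg_right (le_max_right _ _) (sq_nonneg _))

/-- The number of orthonormal eigenfunctions with eigenvalue at most `t` is controlled by the
Sobolev constant. -/
theorem card_le_of_sobolevBound (hm : ∀ x, 0 < m x) (hfin : weightMeasure m Set.univ < ∞)
    (Q : DirichletForm m) {α : ℝ} (hα : 0 ≤ α) {o : X} {S : ℝ} (hS : Q.IsSobolevBound ∞ α o S)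
    {ι : Type*} {v : ι → Ell2 m} (hv : Orthonormal ℂ v) {f : ι → ℝ}
    (hvf : ∀ i, v i ∈ eigenspace Q.generator (f i : ℂ)) (F : Finset ι) {t : ℝ} (ht : 0 ≤ t)
    (hF : ∀ i ∈ F, f i ≤ t) :
    (F.card : ℝ) ≤ max S 0 * (t + α / m o) * (weightMeasure m).real Set.univ := by
  have hmo := hm o
  refine card_le_of_norm_apply_le hm hfin hv F (by positivity) fun c x => ?_
  choose hd hq using fun i => Q.form_of_mem_eigenspace (hvf i)
  let u : Q.domain := ∑ i ∈ F, c i • ⟨v i, hd i⟩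
  have hu : (u : Ell2 m) = ∑ i ∈ F, c i • v i := by simp [u]
  have hnorm : ‖(u : Ell2 m)‖ ^ 2 = ∑ i ∈ F, ‖c i‖ ^ 2 := by
    have h : ⟪(u : Ell2 m), u⟫_ℂ = ((∑ i ∈ F, ‖c i‖ ^ 2 : ℝ) : ℂ) := by
      rw [hu, hv.inner_sum]
      simp [Complex.conj_mul']
    rw [← inner_self_eq_norm_sq (𝕜 := ℂ), h]
    exact Complex.ofReal_re _
  have hquad : Q.quad u ≤ t * ∑ i ∈ F, ‖c i‖ ^ 2 := by
    -- Orthonormal eigenvectors also diagonalize `Q`.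
    have h : Q.form u u = ((∑ i ∈ F, f i * ‖c i‖ ^ 2 : ℝ) : ℂ) := by
      have h1 : Q.form u u = ∑ i ∈ F, c i * Q.form u ⟨v i, hd i⟩ := by
        conv_lhs => rw [show Q.form u u = Q.form u (∑ i ∈ F, c i • ⟨v i, hd i⟩) from rfl]
        rw [map_sum]
        exact Finset.sum_congr rfl fun i _ => map_smul _ _ _
      rw [h1]
      push_cast
      refine Finset.sum_congr rfl fun i hi => ?_
      rw [hq, hu, hv.inner_left_sum c hi, ← Complex.mul_conj']
      ring
    rw [quad, h, Complex.ofReal_re, Finset.mul_sum]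
    exact Finset.sum_le_sum fun i hi => mul_le_mul_of_nonneg_right (hF i hi) (sq_nonneg _)
  rw [← hu, mul_assoc, add_mul]
  refine (Q.norm_apply_sq_le hm hα hS u x).trans (mul_le_mul_of_nonneg_left ?_ (le_max_right _ _))
  rw [hnorm]
  exact add_le_add_left hquad _

end Sobolev

/-! ### Discreteness of the spectrum -/

section Spectrum

variable {X : Type*} [MeasurableSpace X] {m : X → ℝ} (Q : DirichletForm m)

theorem finiteDimensional_eigenspace (hK : IsCompactOperator Q.resolventOp) (z : ℂ) :
    FiniteDimensional ℂ (eigenspace Q.generator z) := by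
  by_cases hz : z + 1 = 0
  · have h : eigenspace Q.generator z = ⊥ := (Submodule.eq_bot_iff _).2 fun u hu => by
      rw [mem_generator_eigenspace_iff_resolventOp, hz, zero_smul] at hu
      exact hu.symm
    rw [h]
    infer_instance
  · have := ContinuousLinearMap.finite_dimensional_eigenspace hK (z + 1)⁻¹ (inv_ne_zero hz)
    refine Submodule.finiteDimensional_of_le (fun u hu => ?_ :
      eigenspace Q.generator z ≤ Module.End.eigenspace Q.resolventOp.toLinearMap (z + 1)⁻¹)
    rw [mem_generator_eigenspace_iff_resolventOp] at hu
    rw [Module.End.mem_eigenspace_iff]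
    exact (eq_inv_smul_iff₀ hz).2 hu

/-- If `(L + 1)⁻¹` is compact, there is an orthonormal basis of eigenvectors. -/
theorem exists_orthonormal_eigenvectors (hK : IsCompactOperator Q.resolventOp) :
    ∃ v : (Σ μ : ℝ, Fin (Module.finrank ℂ (eigenspace Q.generator (μ : ℂ)))) → Ell2 m,
      Orthonormal ℂ v ∧ (∀ a, v a ∈ eigenspace Q.generator (a.1 : ℂ)) ∧
      (Submodule.span ℂ (Set.range v)).topologicalClosure = ⊤ := by
  have := Q.finiteDimensional_eigenspace hK
  exact Q.orthogonalFamily_eigenspace.exists_orthonormal_sigma (Q.iSup_eigenspace_orthogonal hK)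

/-- If there are only finitely many eigenvalues below any threshold, compactness of `(L + 1)⁻¹`
implies that the spectrum is purely discrete. -/
theorem hasPurelyDiscreteSpectrum (hK : IsCompactOperator Q.resolventOp)
    (hfin : ∀ t : ℝ, {μ : ℝ | μ ≤ t ∧ eigenspace Q.generator (μ : ℂ) ≠ ⊥}.Finite) :
    HasPurelyDiscreteSpectrum Q.generator := by
  intro z hz
  refine ⟨fun hacc => ?_, Q.eigenspace_ne_bot_of_mem_spectrum hK hz,
    Q.finiteDimensional_eigenspace hK z⟩
  -- Spectral points in the unit ball about `z` are real eigenvalues at most `z.re + 1`, of which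
  -- there are finitely many.
  have h1 : AccPt z (𝓟 (Metric.ball z 1 ∩ operatorSpectrum Q.generator)) :=
    hacc.nhds_inter (Metric.ball_mem_nhds z one_pos)
  refine Set.Infinite.of_accPt h1 (((hfin (z.re + 1)).image Complex.ofReal).subset ?_)
  rintro w ⟨hw, hws⟩
  have hne := Q.eigenspace_ne_bot_of_mem_spectrum hK hws
  have hwr : ((w.re : ℝ) : ℂ) = w := by
    by_contra h
    exact hne (Q.eigenspace_eq_bot_of_ne h)
  refine ⟨w.re, ⟨?_, by rwa [hwr]⟩, hwr⟩
  have h2 := (Complex.abs_re_le_norm (w - z)).trans_lt (mem_ball_iff_norm.1 hw)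
  rw [Complex.sub_re] at h2
  linarith [(abs_lt.1 h2).2]

end Spectrum

end DirichletForm

/-- A total orthonormal system in `ℓ²(X, m)` has as many elements as `X`, where infinite
cardinalities are not distinguished. -/
theorem card_eq_of_orthonormal {X : Type*} [MeasurableSpace X] [DiscreteMeasurableSpace X]
    {m : X → ℝ} (hm : ∀ x, 0 < m x) {ι : Type*} {v : ι → Ell2 m} (hv : Orthonormal ℂ v)
    (hspan : (Submodule.span ℂ (Set.range v)).topologicalClosure = ⊤) :
    ENat.card ι = ENat.card X := by
  have hfd : Finite ι → FiniteDimensional ℂ (Ell2 m) ∧ Module.finrank ℂ (Ell2 m) = Nat.card ι := by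
    intro hι
    have := Fintype.ofFinite ι
    have h1 : Submodule.span ℂ (Set.range v) = ⊤ := by
      have := FiniteDimensional.span_of_finite ℂ (Set.finite_range v)
      rw [← hspan, (Submodule.closed_of_finiteDimensional _).submodule_topologicalClosure_eq]
    let b := Module.Basis.mk hv.linearIndependent h1.ge
    exact ⟨b.finiteDimensional_of_finite, by
      rw [Module.finrank_eq_card_basis b, Nat.card_eq_fintype_card]⟩
  by_cases hX : Finite X
  · obtain ⟨hf, hr⟩ := finrank_ell2 hm
    have hι : Finite ι := hv.linearIndependent.finite_of_isNoetherian
    rw [ENat.card_eq_coe_natCard, ENat.card_eq_coe_natCard, ← hr, (hfd hι).2]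
  · have hι : ¬ Finite ι := fun hι => by
      have := (hfd hι).1
      exact hX (finite_of_finiteDimensional hm)
    have := not_finite_iff_infinite.1 hX
    have := not_finite_iff_infinite.1 hι
    rw [ENat.card_eq_top_of_infinite, ENat.card_eq_top_of_infinite]

end DiscreteDirichlet

end

/-! ### The main theorem -/

theorem mainTheorem1 {X : Type*} [Countable X] [MeasurableSpace X] [DiscreteMeasurableSpace X]
    (m : X → ℝ) (hm : ∀ x, 0 < m x)
    (hfin : DiscreteDirichlet.weightMeasure m Set.univ < ∞)
    (Q : DiscreteDirichlet.DirichletForm m) (α : ℝ) (hα : 0 ≤ α) (o : X)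
    (hQ : Q.SobolevInequality ∞ α o) :
    DiscreteDirichlet.HasPurelyDiscreteSpectrum Q.generator ∧
    ∃ lam : ℕ → ℝ,
      DiscreteDirichlet.IsEigenvalueEnumeration Q.generator (ENat.card X) lam ∧
      ∀ k : ℕ, 1 ≤ k → (k : ℕ∞) ≤ ENat.card X →
        (k : ℝ) / (Q.sobolevConstant ∞ α o * (DiscreteDirichlet.weightMeasure m).real Set.univ)
          - α / m o ≤ lam k := by
  have hS := (Q.isLeast_sobolevConstant hm ∞ ENNReal.top_ne_zero hα o hQ).1
  have hK := Q.isCompactOperator_resolventOp hm hfin hα hS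
  obtain ⟨v, hv, hve, hspan⟩ := Q.exists_orthonormal_eigenvectors hK
  have hcard := DiscreteDirichlet.card_eq_of_orthonormal hm hv hspan
  have hbound := fun F t ht hF => Q.card_le_of_sobolevBound hm hfin hα hS hv
    (f := fun a => a.1) hve F (t := t) ht hF
  have hf : ∀ t : ℝ, {a : Σ μ : ℝ, Fin (Module.finrank ℂ
      (DiscreteDirichlet.eigenspace Q.generator (μ : ℂ))) | a.1 ≤ t}.Finite := fun t => by
    by_contra hinf
    -- The counting bound needs a nonnegative threshold, hence `max t 0`.
    obtain ⟨n, hn⟩ := exists_nat_gt (max (Q.sobolevConstant ∞ α o) 0 * (max t 0 + α / m o) *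
      (DiscreteDirichlet.weightMeasure m).real Set.univ)
    obtain ⟨F, hF, hFn⟩ := Set.Infinite.exists_subset_card_eq hinf n
    have := hbound F (max t 0) (le_max_right _ _) fun a ha => (hF ha).trans (le_max_left _ _)
    rw [hFn] at this
    exact absurd hn (not_lt.2 this)
  have hfd := Q.finiteDimensional_eigenspace hK
  refine ⟨Q.hasPurelyDiscreteSpectrum hK fun t => ((hf t).image Sigma.fst).subset ?_, ?_⟩
  · rintro μ ⟨hμ, hne⟩
    have : Nontrivial (DiscreteDirichlet.eigenspace Q.generator (μ : ℂ)) :=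
      Submodule.nontrivial_iff_ne_bot.2 hne
    exact ⟨⟨μ, ⟨0, Module.finrank_pos⟩⟩, hμ, rfl⟩
  obtain ⟨r, hr, hrange, hmono⟩ := DiscreteDirichlet.exists_monotone_numbering _ hf
  rw [hcard] at hrange
  have hlam : ∀ a, Function.extend r Sigma.fst 0 (r a) = a.1 := hr.extend_apply _ _
  -- The default value `0` is taken only at indices outside `1 ≤ k ≤ |X|`.
  refine ⟨Function.extend r Sigma.fst 0, ⟨fun i j hi hij hj => ?_, fun z => ?_⟩, fun k hk hkX => ?_⟩
  · obtain ⟨a, rfl⟩ := hrange.ge ⟨hi, (Nat.cast_le.2 hij).trans hj⟩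
    obtain ⟨b, rfl⟩ := hrange.ge ⟨hi.trans hij, hj⟩
    rw [hlam, hlam]
    exact hmono a b hij
  · have hset : {k : ℕ | 1 ≤ k ∧ (k : ℕ∞) ≤ ENat.card X ∧
        ((Function.extend r Sigma.fst 0 k : ℝ) : ℂ) = z} = r '' {a | (a.1 : ℂ) = z} := by
      ext k
      constructor
      · rintro ⟨h1, h2, h3⟩
        obtain ⟨a, rfl⟩ := hrange.ge ⟨h1, h2⟩
        rw [hlam] at h3
        exact ⟨a, h3, rfl⟩
      · rintro ⟨a, ha, rfl⟩
        have h := hrange.le ⟨a, rfl⟩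
        exact ⟨h.1, h.2, by rw [hlam]; exact ha⟩
    rw [hset, hr.encard_image, ← Module.finrank_eq_rank, Cardinal.toENat_nat]
    by_cases hz : ((z.re : ℝ) : ℂ) = z
    · have h1 : {a : Σ μ : ℝ, Fin (Module.finrank ℂ
          (DiscreteDirichlet.eigenspace Q.generator (μ : ℂ))) | (a.1 : ℂ) = z} =
          Sigma.mk z.re '' Set.univ := by
        ext ⟨μ, i⟩
        constructor
        · intro h
          have h : (μ : ℂ) = z := h
          subst h
          exact ⟨i, trivial, rfl⟩
        · rintro ⟨j, -, hj⟩
          rw [← hj]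
          exact hz
      rw [h1, sigma_mk_injective.encard_image, Set.encard_univ, ENat.card_eq_coe_fintype_card,
        Fintype.card_fin, hz]
    · rw [Q.eigenspace_eq_bot_of_ne hz, finrank_bot, Nat.cast_zero, Set.encard_eq_zero]
      exact Set.eq_empty_of_forall_notMem fun a (ha : (a.1 : ℂ) = z) =>
        hz (by rw [← ha, Complex.ofReal_re])
  · obtain ⟨a, rfl⟩ := hrange.ge ⟨hk, hkX⟩
    rw [hlam]
    have ha0 : 0 ≤ a.1 := (Q.re_nonneg_of_mem_eigenspace (hve a) (hv.ne_zero a)).1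
    -- Cutting by rank rather than by eigenvalue gives exactly `k = r a` eigenfunctions, all with
    -- eigenvalue at most `a.1`.
    have hfs : {b | r b ≤ r a}.Finite := (hf a.1).subset fun b hb => hmono b a hb
    have himg : r '' {b | r b ≤ r a} = Set.Icc 1 (r a) := by
      ext k
      constructor
      · rintro ⟨b, hb, rfl⟩
        exact ⟨(hrange.le ⟨b, rfl⟩).1, hb⟩
      · rintro ⟨h1, h2⟩
        obtain ⟨b, rfl⟩ := hrange.ge ⟨h1, (Nat.cast_le.2 h2).trans hkX⟩
        exact ⟨b, h2, rfl⟩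
    have hcard' : hfs.toFinset.card = r a := by
      rw [← Set.ncard_eq_toFinset_card _ hfs, ← Set.ncard_image_of_injective _ hr, himg,
        Set.ncard_eq_toFinset_card']
      simp
    have h := hbound hfs.toFinset a.1 ha0 fun b hb => hmono b a (hfs.mem_toFinset.1 hb)
    rw [hcard'] at h
    have hra : (0 : ℝ) < r a := by exact_mod_cast hk
    have hmo := hm o
    have hβ : 0 ≤ a.1 + α / m o := by positivity
    -- Otherwise the counting bound would read `r a ≤ 0`.
    have hSpos : 0 < Q.sobolevConstant ∞ α o := by
      by_contra hneg
      rw [max_eq_right (not_lt.1 hneg), zero_mul, zero_mul] at h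
      linarith
    rw [max_eq_left hSpos.le] at h
    have hMpos : 0 < (DiscreteDirichlet.weightMeasure m).real Set.univ := by
      refine lt_of_le_of_ne measureReal_nonneg fun h0 => ?_
      rw [← h0, mul_zero] at h
      linarith
    rw [sub_le_iff_le_add, div_le_iff₀ (mul_pos hSpos hMpos)]
    linarith
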